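/- Let $\mathcal G$ be a finite directed acyclic graph with vertex set $\mathbf V$ (latent variables may be among the vertices), and consider a structural causal model with graph $\mathcal G$: real random variables $V_i=f_i(pa(V_i),U_i)$ with measurable $f_i$ and mutually independent exogenous variables $U_i$ taking values in standard Borel spaces. Let $X\neq Y$ be two of the variables, such that $Y$ is not an ancestor of $X$. A path is a path with distinct vertices in the skeleton of $\mathcal G$; it is blocked by a set $\mathbf S$ if some interior non-collider of it lies in $\mathbf S$, or some collider of it neither lies in $\mathbf S$ nor has a descendant in $\mathbf S$; it is active if it is not blocked by $\emptyset$. A backdoor path from $A$ to $B$ is one that starts with an edge into $A$; a mediator path is a directed path with at least one interior vertex. Let - $\mathbf Z_1$ (confounders) be the set of non-descendants of $X$, other than $X$ and $Y$, that are interior vertices of an active backdoor path from $X$ to $Y$; - $\mathbf Z_3$ (mediators) be the set of descendants of $X$ that are ancestors of $Y$; - $\mathbf Z_4$ be the set of non-descendants of $Y$, other than $X$ and $Y$, that are $d$-separated from $X$ by $\emptyset$ but not by $\{Y\}$; and $\mathbf A_{DE}:=(\mathbf Z_1\cup\mathbf Z_3\cup\mathbf Z_4)\cap pa(Y)$. If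 $X$ and $Y$ are not $d$-separated by $\emptyset$, then $\mathbf A_{DE}=pa(Y)\setminus\{X\}$. In every case each of the sets $\mathbf A=\mathbf A_{DE}$ and $\mathbf A=pa(Y)\setminus\{X\}$ is a valid adjustment set for the weighted controlled direct effect of $X$ on $Y$, in the following sense. 1. $\mathbf A$ blocks all backdoor paths from $X$ to $Y$, all mediator paths from $X$ to $Y$, and all paths from $X$ to $Y$ that contain a collider. For each mediator $M\in\mathbf Z_3$, the set $\mathbf A\cup\{X\}$ blocks all backdoor paths from $M$ to $Y$ and all paths from $M$ to $Y$ that contain a collider. 2. Let $\mathbf M\subseteq\mathbf Z_3$ be any set of mediators that contains $\mathbf M'=\mathbf Z_3\cap pa(Y)$ (for example $\mathbf M=\mathbf M'$ or $\mathbf M=\mathbf Z_3$), and let $Y_{x,\mathbf m}$ be the value of $Y$ under the intervention $do(X=x,\mathbf M=\mathbf m)$. For $\mathbf S=\mathbf A$ and for $\mathbf S=\mathbf A\setminus\mathbf M$, and for all $x,\mathbf m$, $$Y_{x,\mathbf m}\perp X\mid\mathbf S\qquad\text{and}\qquad Y_{x,\mathbf m}\perp\mathbf M\mid X,\mathbf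 S .$$ 3. Let $\mathbf M$ be as in 2, $\mathbf S=\mathbf A\setminus\mathbf M$, and let $x,x^*$ be two values of $X$. Suppose that the variables in $\mathbf A\cup\mathbf M$ are discrete, that $P(x,\mathbf s,\mathbf m)>0$ and $P(x^*,\mathbf s,\mathbf m)>0$ whenever $P(\mathbf s)>0$ and $P(\mathbf m)>0$, and that $Y_{x,\mathbf m}$ and $Y_{x^*,\mathbf m}$ are integrable whenever $P(\mathbf m)>0$. Then for each $\mathbf m$ with $P(\mathbf m)>0$ the conditional expectations below (for $P(\mathbf s)>0$) exist and $$\mathrm{CDE}(\mathbf m):=\mathbb E[Y\mid do(x,\mathbf m)]-\mathbb E[Y\mid do(x^*,\mathbf m)]=\sum_{\mathbf s}\big(\mathbb E[Y\mid x,\mathbf s,\mathbf m]-\mathbb E[Y\mid x^*,\mathbf s,\mathbf m]\big)P(\mathbf s),$$ with a convergent sum; and, if $\sum_{\mathbf m}\mathrm{CDE}(\mathbf m)P(\mathbf m)$ converges absolutely, then $$\mathrm{WCDE}:=\sum_{\mathbf m}\mathrm{CDE}(\mathbf m)P(\mathbf m)=\sum_{\mathbf m}\sum_{\mathbf s}\big(\mathbb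 E[Y\mid x,\mathbf s,\mathbf m]-\mathbb E[Y\mid x^*,\mathbf s,\mathbf m]\big)P(\mathbf s)P(\mathbf m).$$ -/

import Mathlib

open MeasureTheory ProbabilityTheory

/-- A directed acyclic graph on the vertex set `V`; `edge i j` means `i → j`. -/
structure CausalDAG (V : Type*) where
  edge : V → V → Prop
  acyclic : ∀ i, ¬ Relation.TransGen edge i i

namespace CausalDAG

/-- The edge relation of a finite acyclic graph is well-founded. -/
theorem wf {V : Type*} [Finite V] (G : CausalDAG V) : WellFounded G.edge := by
  have : Std.Irrefl (Relation.TransGen G.edge) := ⟨G.acyclic⟩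
  have h : WellFounded (Relation.TransGen G.edge) :=
    Finite.wellFounded_of_trans_of_irrefl _
  exact Subrelation.wf (fun hab => Relation.TransGen.single hab) h

/-- The set `pa(v)` of parents of `v`. -/
def parents {V : Type*} (G : CausalDAG V) (v : V) : Set V := {i | G.edge i v}

/-- There is a directed path of positive length from `i` to `j`. -/
def IsAncestor {V : Type*} (G : CausalDAG V) (i j : V) : Prop := Relation.TransGen G.edge i j

/-- A path from `a` to `b` in the skeleton of `G`: pairwise distinct vertices
`node 0 = a, node 1, …, node len = b`, consecutive ones joined by an edge of either direction.
The values of `node` beyond `len` play no role. -/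
structure Path {V : Type*} (G : CausalDAG V) (a b : V) where
  len : ℕ
  node : ℕ → V
  first : node 0 = a
  last : node len = b
  adj : ∀ i < len, G.edge (node i) (node (i + 1)) ∨ G.edge (node (i + 1)) (node i)
  inj : Set.InjOn node (Set.Iic len)

/-- `node i` is an interior vertex of the path at which both path edges point into it. -/
def Path.IsCollider {V : Type*} {G : CausalDAG V} {a b : V} (p : G.Path a b) (i : ℕ) : Prop :=
  0 < i ∧ i < p.len ∧ G.edge (p.node (i - 1)) (p.node i) ∧ G.edge (p.node (i + 1)) (p.node i)

/-- A path is blocked by `S` if some interior non-collider of it lies in `S`, or some collider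
of it is neither in `S` nor has a descendant in `S`. -/
def Path.Blocked {V : Type*} {G : CausalDAG V} {a b : V} (p : G.Path a b) (S : Set V) : Prop :=
  ∃ i, 0 < i ∧ i < p.len ∧
    ((¬ p.IsCollider i ∧ p.node i ∈ S) ∨
      (p.IsCollider i ∧ ∀ d, Relation.ReflTransGen G.edge (p.node i) d → d ∉ S))

/-- A backdoor path from `a` to `b` starts with an edge into `a`. -/
def Path.IsBackdoor {V : Type*} {G : CausalDAG V} {a b : V} (p : G.Path a b) : Prop :=
  0 < p.len ∧ G.edge (p.node 1) (p.node 0)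

/-- A mediator (frontdoor) path from `a` to `b` is a directed path with at least one interior
vertex. -/
def Path.IsMediatorPath {V : Type*} {G : CausalDAG V} {a b : V} (p : G.Path a b) : Prop :=
  2 ≤ p.len ∧ ∀ i < p.len, G.edge (p.node i) (p.node (i + 1))

/-- `a` and `b` are `d`-separated by `S`. -/
def DSep {V : Type*} (G : CausalDAG V) (a b : V) (S : Set V) : Prop :=
  ∀ p : G.Path a b, p.Blocked S

/-- Confounders of `{x, y}`: non-descendants of `x` that are interior vertices of an active
(unconditionally unblocked) backdoor path from `x` to `y`. -/
def Z1 {V : Type*} (G : CausalDAG V) (x y : V) : Set V :=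
  {v | v ≠ x ∧ v ≠ y ∧ ¬ G.IsAncestor x v ∧
    ∃ p : G.Path x y, p.IsBackdoor ∧ ¬ p.Blocked ∅ ∧ ∃ i, 0 < i ∧ i < p.len ∧ p.node i = v}

/-- Mediators of `{x, y}`: descendants of `x` that are ancestors of `y`. -/
def Z3 {V : Type*} (G : CausalDAG V) (x y : V) : Set V :=
  {v | G.IsAncestor x v ∧ G.IsAncestor v y}

/-- Non-descendants of `y` that are marginally separated from `x` but not given `y`. -/
def Z4 {V : Type*} (G : CausalDAG V) (x y : V) : Set V :=
  {v | v ≠ x ∧ v ≠ y ∧ ¬ G.IsAncestor y v ∧ G.DSep v x ∅ ∧ ¬ G.DSep v x {y}}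

/-- The set `A_DE`: confounders, mediators and members of `Z4` that are parents of `y`. -/
def ADE {V : Type*} (G : CausalDAG V) (x y : V) : Set V :=
  (G.Z1 x y ∩ G.parents y) ∪ (G.Z3 x y ∩ G.parents y) ∪ (G.Z4 x y ∩ G.parents y)

/-- The graphical requirements on an adjustment set for the weighted controlled direct effect.
Confounding of mediators and outcome is controlled given the exposure and the adjustment set. -/
structure IsGraphicalVAS {V : Type*} (G : CausalDAG V) (x y : V) (A : Set V) : Prop where
  backdoor_exposure : ∀ p : G.Path x y, p.IsBackdoor → p.Blocked A
  backdoor_mediators : ∀ v ∈ G.Z3 x y, ∀ p : G.Path v y, p.IsBackdoor → p.Blocked (insert x A)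
  mediator_paths : ∀ p : G.Path x y, p.IsMediatorPath → p.Blocked A
  collider_paths_exposure : ∀ p : G.Path x y, (∃ i, p.IsCollider i) → p.Blocked A
  collider_paths_mediators : ∀ v ∈ G.Z3 x y, ∀ p : G.Path v y, (∃ i, p.IsCollider i) →
    p.Blocked (insert x A)

/-- The sets of mediators that one may hold fixed: they contain every mediator that is a parent
of `y`. -/
def IsMediatorSet {V : Type*} (G : CausalDAG V) (x y : V) (M : Set V) : Prop :=
  G.Z3 x y ∩ G.parents y ⊆ M ∧ M ⊆ G.Z3 x y

end CausalDAG

/-- A structural causal model with causal graph `G`: real endogenous variables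
`V_i = f_i (pa(V_i), U_i)`, exogenous variables `U_i` with values in `𝓤 i` and joint law `law`. -/
structure SCM {V : Type*} (G : CausalDAG V) (𝓤 : V → Type*) [∀ i, MeasurableSpace (𝓤 i)] where
  f : ∀ i, ({j // G.edge j i} → ℝ) → 𝓤 i → ℝ
  measurable_f : ∀ i, Measurable (Function.uncurry (f i))
  law : Measure (∀ i, 𝓤 i)
  isProb : IsProbabilityMeasure law

namespace SCM

section

variable {V : Type*} {G : CausalDAG V} {𝓤 : V → Type*} [∀ i, MeasurableSpace (𝓤 i)]

instance (C : SCM G 𝓤) : IsProbabilityMeasure C.law := C.isProb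

/-- The exogenous variables are mutually independent. -/
def Markovian (C : SCM G 𝓤) : Prop :=
  iIndepFun (fun (i : V) (u : ∀ i, 𝓤 i) => u i) C.law

/-- The submodel under an intervention: where `d i = some c`, the structural function of `V_i`
is replaced by the constant `c`. -/
def intervene (C : SCM G 𝓤) (d : V → Option ℝ) : SCM G 𝓤 where
  f i := match d i with
    | some c => fun _ _ => c
    | none => C.f i
  measurable_f i := by
    cases h : d i with
    | some c => exact measurable_const
    | none => exact C.measurable_f i
  law := C.law
  isProb := C.isProb

variable [Finite V]

/-- The endogenous variables, obtained by solving the structural equations recursively. -/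
noncomputable def value (C : SCM G 𝓤) (u : ∀ i, 𝓤 i) : V → ℝ :=
  G.wf.fix (C := fun _ => ℝ) (fun i rec => C.f i (fun j : {j // G.edge j i} => rec j.1 j.2) (u i))

/-- The endogenous variables satisfy the structural equations. -/
theorem value_eq (C : SCM G 𝓤) (u : ∀ i, 𝓤 i) (i : V) :
    C.value u i = C.f i (fun j => C.value u j.1) (u i) := by
  unfold value
  rw [WellFounded.fix_eq]

theorem measurable_value (C : SCM G 𝓤) (i : V) : Measurable (fun u => C.value u i) := by
  induction i using G.wf.induction with
  | _ i ih =>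
    have : (fun u => C.value u i) = fun u : (∀ i, 𝓤 i) =>
        Function.uncurry (C.f i) ((fun j : {j // G.edge j i} => C.value u j.1), u i) := by
      funext u
      exact C.value_eq u i
    rw [this]
    exact (C.measurable_f i).comp
      ((measurable_pi_lambda _ fun j : {j // G.edge j i} => ih j.1 j.2).prodMk (measurable_pi_apply i))

/-- The random vector of the endogenous variables in `S`. -/
noncomputable def vec (C : SCM G 𝓤) (S : Set V) (u : ∀ i, 𝓤 i) : S → ℝ :=
  fun i => C.value u i.1

theorem measurable_vec (C : SCM G 𝓤) (S : Set V) : Measurable (C.vec S) :=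
  measurable_pi_lambda _ fun i => C.measurable_value i.1

/-- `P(S = s)`. -/
noncomputable def prob (C : SCM G 𝓤) (S : Set V) (s : S → ℝ) : ℝ :=
  C.law.real {u | C.vec S u = s}

/-- The event `{X = a, S = s, M = m}`. -/
def event (C : SCM G 𝓤) (x : V) (S M : Set V) (a : ℝ) (s : S → ℝ) (m : M → ℝ) :
    Set (∀ i, 𝓤 i) :=
  {u | C.value u x = a ∧ C.vec S u = s ∧ C.vec M u = m}

/-- `E[Y | X = a, S = s, M = m]`, the mean of `Y` under the law conditioned on that event. -/
noncomputable def condMean (C : SCM G 𝓤) (x y : V) (S M : Set V) (a : ℝ) (s : S → ℝ)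
    (m : M → ℝ) : ℝ :=
  ∫ u, C.value u y ∂(C.law[|C.event x S M a s m])

open Classical in
/-- The intervention `do(X = a, M = m)`. -/
noncomputable def doXM (x : V) (M : Set V) (a : ℝ) (m : M → ℝ) : V → Option ℝ :=
  fun i => if i = x then some a else if h : i ∈ M then some (m ⟨i, h⟩) else none

/-- The potential outcome `Y_{a,m}`: the value of `Y` under `do(X = a, M = m)`. -/
noncomputable def potentialOutcome (C : SCM G 𝓤) (x y : V) (M : Set V) (a : ℝ) (m : M → ℝ)
    (u : ∀ i, 𝓤 i) : ℝ :=
  (C.intervene (doXM x M a m)).value u y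

/-- `CDE(m) = E[Y | do(X = a, M = m)] - E[Y | do(X = a', M = m)]`. -/
noncomputable def CDE (C : SCM G 𝓤) (x y : V) (M : Set V) (a a' : ℝ) (m : M → ℝ) : ℝ :=
  (∫ u, C.potentialOutcome x y M a m u ∂C.law) - ∫ u, C.potentialOutcome x y M a' m u ∂C.law

/-- The weighted controlled direct effect `∑_m CDE(m) P(m)`. -/
noncomputable def WCDE (C : SCM G 𝓤) (x y : V) (M : Set V) (a a' : ℝ) : ℝ :=
  ∑' m : M → ℝ, C.CDE x y M a a' m * C.prob M m

/-- The adjustment formula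
`∑_m ∑_s (E[Y | X = a, s, m] - E[Y | X = a', s, m]) P(s) P(m)`. -/
noncomputable def adjustedWCDE (C : SCM G 𝓤) (x y : V) (S M : Set V) (a a' : ℝ) : ℝ :=
  ∑' m : M → ℝ, ∑' s : S → ℝ,
    (C.condMean x y S M a s m - C.condMean x y S M a' s m) * C.prob S s * C.prob M m

/-- The variables in `S` are discrete. -/
def DiscreteOn (C : SCM G 𝓤) (S : Set V) : Prop :=
  ∀ i ∈ S, ∃ D : Set ℝ, D.Countable ∧ ∀ᵐ u ∂C.law, C.value u i ∈ D

/-- Positivity (overlap): `P(X = a, s, m) > 0` whenever `P(s) > 0` and `P(m) > 0`. -/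
def Positivity (C : SCM G 𝓤) (x : V) (S M : Set V) (a : ℝ) : Prop :=
  ∀ (s : S → ℝ) (m : M → ℝ), 0 < C.prob S s → 0 < C.prob M m →
    0 < C.law.real (C.event x S M a s m)

/-- The expectations `E[Y | do(X = a, M = m)]` exist for all `m` with `P(m) > 0`. -/
def HasDoMeans (C : SCM G 𝓤) (x y : V) (M : Set V) (a : ℝ) : Prop :=
  ∀ m : M → ℝ, 0 < C.prob M m → Integrable (C.potentialOutcome x y M a m) C.law

/-- Absence of latent confounding given `S`: `Y_{a,m} ⊥ X | S` and `Y_{a,m} ⊥ M | X, S` for all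
`a` and `m`. -/
def NoLatentConfounding [∀ i, StandardBorelSpace (𝓤 i)] (C : SCM G 𝓤) (x y : V)
    (M S : Set V) : Prop :=
  ∀ (a : ℝ) (m : M → ℝ),
    CondIndepFun (MeasurableSpace.comap (C.vec S) inferInstance) (C.measurable_vec S).comap_le
      (C.potentialOutcome x y M a m) (fun u => C.value u x) C.law ∧
    CondIndepFun (MeasurableSpace.comap (C.vec (insert x S)) inferInstance)
      (C.measurable_vec (insert x S)).comap_le
      (C.potentialOutcome x y M a m) (C.vec M) C.law

/-- Adjustment for `A` identifies the controlled direct effects and the weighted controlled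
direct effect of `M` by the adjustment formula; the mediators in `M` enter through `m` and the
remaining members of `A` through `s`. -/
def Identifies (C : SCM G 𝓤) (x y : V) (M A : Set V) : Prop :=
  ∀ a a' : ℝ, C.DiscreteOn (A ∪ M) →
    C.Positivity x (A \ M) M a → C.Positivity x (A \ M) M a' →
    C.HasDoMeans x y M a → C.HasDoMeans x y M a' →
    (∀ m : M → ℝ, 0 < C.prob M m →
      (∀ s : ↥(A \ M) → ℝ, 0 < C.prob (A \ M) s →
        Integrable (fun u => C.value u y) (C.law[|C.event x (A \ M) M a s m]) ∧
        Integrable (fun u => C.value u y) (C.law[|C.event x (A \ M) M a' s m])) ∧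
      HasSum (fun s : ↥(A \ M) → ℝ =>
        (C.condMean x y (A \ M) M a s m - C.condMean x y (A \ M) M a' s m) *
          C.prob (A \ M) s) (C.CDE x y M a a' m)) ∧
    (Summable (fun m : M → ℝ => C.CDE x y M a a' m * C.prob M m) →
      C.WCDE x y M a a' = C.adjustedWCDE x y (A \ M) M a a')

/-- `A` is a valid adjustment set for the weighted controlled direct effect of `x` on `y`: it has
the required blocking properties, there is no latent confounding given `A` (with or without the
mediators that are held fixed), and adjustment for `A` identifies the effect. -/
structure IsVAS [∀ i, StandardBorelSpace (𝓤 i)] (C : SCM G 𝓤) (x y : V) (A : Set V) :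
    Prop where
  graphical : G.IsGraphicalVAS x y A
  no_latent_confounding : ∀ M, G.IsMediatorSet x y M →
    C.NoLatentConfounding x y M A ∧ C.NoLatentConfounding x y M (A \ M)
  identifies : ∀ M, G.IsMediatorSet x y M → C.Identifies x y M A

end

end SCM

/-! Graphically, everything rests on one fact: two vertices are `d`-connected given `∅` exactly when
they have a common ancestor, the connecting path being a trek (`exists_trek`, `not_dSep_empty_iff`).
If `x` and `y` are connected, each parent `v ≠ x` of `y` is a mediator, or shares an ancestor with
`x` without descending from it and is a confounder, or is separated from `x` and becomes connected
to it through the collider at `y`. So `ADE` is `pa(y) \ {x}`, and this set blocks every path of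
length at least two into `y` (`Path.blocked_of_parents_subset`). If they are separated, `ADE` and
`Z3` are empty.

Probabilistically, both sets satisfy `FactorsThrough`: the potential outcome is `g(S, R)` with `S =
A \ M` and noise `R` independent of the exogenous variables of an ancestral set `N` that contains
`x`, `A` and the mediators. For `pa(y) \ {x}`, `R` is `U_y` and `g` is the structural function of
`y` with `x` and `M` held fixed. For `∅`, `R` is the outcome itself, driven by ancestors that `x`
does not share.

From `g(S, R)` the conditional independences follow at once (`condIndepFun_of_indep_noise`).
Together with consistency, freezing `S = s` turns each term of the adjustment formula into the
integral of the potential outcome over `{S = s}`, and these events partition the space. -/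

namespace CausalDAG

/-! ### Paths, treks and marginal `d`-separation -/

section

variable {V : Type*} {G : CausalDAG V}

/-- Prolong a path by an edge at its start. -/
def Path.cons {a b c : V} (q : G.Path a b) (h : G.edge c a ∨ G.edge a c)
    (hc : ∀ i ≤ q.len, q.node i ≠ c) : G.Path c b where
  len := q.len + 1
  node := fun n => Nat.casesOn n c q.node
  first := rfl
  last := q.last
  adj := by
    rintro (_ | i) hi
    · simpa [q.first] using h
    · exact q.adj i (by omega)
  inj := by
    rintro (_ | i) hi (_ | j) hj hij
    · rfl
    · exact absurd hij.symm (hc j (by simpa using hj))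
    · exact absurd hij (hc i (by simpa using hi))
    · have := q.inj (by simpa using hi) (by simpa using hj) hij
      omega

/-- Prolong a path by an edge at its end. -/
def Path.snoc {a b c : V} (q : G.Path a b) (h : G.edge b c ∨ G.edge c b)
    (hc : ∀ i ≤ q.len, q.node i ≠ c) : G.Path a c where
  len := q.len + 1
  node := fun n => if n ≤ q.len then q.node n else c
  first := by simp [q.first]
  last := by simp
  adj := by
    intro i hi
    by_cases h' : i < q.len
    · simpa [h'.le, Nat.succ_le_of_lt h'] using q.adj i h'
    · obtain rfl : i = q.len := by omega
      simpa [q.last] using h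
  inj := by
    intro i hi j hj hij
    simp only [Set.mem_Iic] at hi hj
    dsimp only at hij
    split_ifs at hij with h1 h2 h2
    · exact q.inj h1 h2 hij
    · exact absurd hij (hc i h1)
    · exact absurd hij.symm (hc j h2)
    · omega

theorem not_edge_of_edge {a b : V} (h : G.edge a b) : ¬ G.edge b a := fun h' =>
  G.acyclic a ((Relation.TransGen.single h).tail h')

/-- A vertex reachable from `a` along a directed path is reached by one without repetitions. -/
theorem exists_directedPath {a b : V} (h : Relation.ReflTransGen G.edge a b) :
    ∃ p : G.Path a b, (∀ i < p.len, G.edge (p.node i) (p.node (i + 1))) ∧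
      ∀ i ≤ p.len, Relation.ReflTransGen G.edge a (p.node i) := by
  induction h using Relation.ReflTransGen.head_induction_on with
  | refl => exact ⟨⟨0, fun _ => b, rfl, rfl, by simp, by intro i hi j hj; simp_all⟩, by simp,
      fun _ _ => .refl⟩
  | @head a c hac _ ih =>
    obtain ⟨q, hq, hr⟩ := ih
    refine ⟨q.cons (Or.inl hac) fun i hi h => ?_, ?_, ?_⟩
    · have := hr i hi
      rw [h] at this
      exact G.acyclic a (Relation.TransGen.head' hac this)
    · rintro (_ | i) hi
      · simpa [Path.cons, q.first] using hac
      · exact hq i (by simpa [Path.cons] using hi)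
    · rintro (_ | i) hi
      · exact .refl
      · exact .head hac (hr i (by simpa [Path.cons] using hi))

theorem Path.forward_reach {a b : V} (p : G.Path a b) {k l : ℕ} (hkl : k ≤ l)
    (h : ∀ i, k ≤ i → i < l → G.edge (p.node i) (p.node (i + 1))) :
    Relation.ReflTransGen G.edge (p.node k) (p.node l) := by
  induction l, hkl using Nat.le_induction with
  | base => exact .refl
  | succ l hkl ih => exact (ih fun i h1 h2 => h i h1 (by omega)).tail (h l hkl (by omega))

theorem Path.backward_reach {a b : V} (p : G.Path a b) {k l : ℕ} (hkl : k ≤ l)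
    (h : ∀ i, k ≤ i → i < l → G.edge (p.node (i + 1)) (p.node i)) :
    Relation.ReflTransGen G.edge (p.node l) (p.node k) := by
  induction l, hkl using Nat.le_induction with
  | base => exact .refl
  | succ l hkl ih => exact (ih fun i h1 h2 => h i h1 (by omega)).head (h l hkl (by omega))

/-- The path runs against the edges up to `node k` and along the edges from there on. -/
def Path.IsTrek {a b : V} (p : G.Path a b) (k : ℕ) : Prop :=
  k ≤ p.len ∧ (∀ i < k, G.edge (p.node (i + 1)) (p.node i)) ∧
    ∀ i, k ≤ i → i < p.len → G.edge (p.node i) (p.node (i + 1))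

theorem Path.IsTrek.not_isCollider {a b : V} {p : G.Path a b} {k : ℕ} (h : p.IsTrek k) (i : ℕ) :
    ¬ p.IsCollider i := by
  rintro ⟨h0, h1, h2, h3⟩
  rcases lt_or_ge i k with hik | hik
  · have := h.2.1 (i - 1) (by omega)
    rw [Nat.sub_add_cancel h0] at this
    exact not_edge_of_edge h2 this
  · exact not_edge_of_edge h3 (h.2.2 i hik h1)

theorem Path.IsTrek.reach {a b : V} {p : G.Path a b} {k : ℕ} (h : p.IsTrek k) {i : ℕ}
    (hi : i ≤ p.len) : Relation.ReflTransGen G.edge (p.node k) (p.node i) := by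
  rcases le_total i k with hik | hik
  · exact p.backward_reach hik fun j _ hj => h.2.1 j hj
  · exact p.forward_reach hik fun j hj hj' => h.2.2 j hj (by omega)

theorem Path.IsTrek.reach_ends {a b : V} {p : G.Path a b} {k : ℕ} (h : p.IsTrek k) {i : ℕ}
    (hi : i ≤ p.len) :
    Relation.ReflTransGen G.edge (p.node i) a ∨ Relation.ReflTransGen G.edge (p.node i) b := by
  rcases le_total i k with hik | hik
  · left
    simpa only [p.first] using p.backward_reach (Nat.zero_le i) fun j _ hj => h.2.1 j (by omega)
  · right
    simpa only [p.last] using p.forward_reach hi fun j hj hj' => h.2.2 j (by omega) hj'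

/-- Two vertices with a common ancestor are joined by a trek. -/
theorem exists_trek [Finite V] {a b c : V} (ha : Relation.ReflTransGen G.edge c a)
    (hb : Relation.ReflTransGen G.edge c b) : ∃ (p : G.Path a b) (k : ℕ), p.IsTrek k := by
  have hwf : WellFounded (Function.swap (Relation.TransGen G.edge)) := by
    have : Std.Irrefl (Function.swap (Relation.TransGen G.edge)) := ⟨G.acyclic⟩
    have : IsTrans V (Function.swap (Relation.TransGen G.edge)) := ⟨fun _ _ _ h h' => h'.trans h⟩
    exact Finite.wellFounded_of_trans_of_irrefl _
  -- A lowest common ancestor: no proper descendant of `e` is a common ancestor, so directed paths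
  -- from `e` to `a` and to `b` meet only at `e` and can be glued there.
  obtain ⟨e, ⟨hea, heb⟩, hmax⟩ := hwf.has_min
    {e | Relation.ReflTransGen G.edge e a ∧ Relation.ReflTransGen G.edge e b} ⟨c, ha, hb⟩
  obtain ⟨q, hq, -⟩ := exists_directedPath hea
  obtain ⟨r, hr, -⟩ := exists_directedPath heb
  have key : ∀ i ≤ q.len, ∀ j ≤ r.len, q.node i = r.node j → i = 0 ∧ j = 0 := by
    intro i hi j hj hij
    have h1 : Relation.ReflTransGen G.edge (q.node i) a := by
      simpa only [q.last] using q.forward_reach hi fun k _ hk => hq k hk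
    have h2 : Relation.ReflTransGen G.edge (q.node i) b := by
      rw [hij]
      simpa only [r.last] using r.forward_reach hj fun k _ hk => hr k hk
    have h3 : Relation.ReflTransGen G.edge e (q.node i) := by
      simpa only [q.first] using q.forward_reach (Nat.zero_le i) fun k _ hk => hq k (by omega)
    have h4 : q.node i = e := by
      rcases Relation.reflTransGen_iff_eq_or_transGen.1 h3 with h | h
      · exact h
      · exact absurd h (hmax _ ⟨h1, h2⟩)
    exact ⟨q.inj hi (Nat.zero_le q.len) (h4.trans q.first.symm),
      r.inj hj (Nat.zero_le r.len) ((hij.symm.trans h4).trans r.first.symm)⟩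
  refine ⟨⟨q.len + r.len, fun n => if n ≤ q.len then q.node (q.len - n) else r.node (n - q.len),
    by simp [q.last], ?_, ?_, ?_⟩, q.len, ?_⟩
  · rcases Nat.eq_zero_or_pos r.len with h | h
    · have h1 := r.last
      rw [h, r.first] at h1
      simp [h, q.first, h1]
    · simp [h.ne', r.last]
  · intro i hi
    rcases lt_or_ge i q.len with h | h
    · right
      have := hq (q.len - (i + 1)) (by omega)
      rw [show q.len - (i + 1) + 1 = q.len - i by omega] at this
      simpa [h.le, Nat.succ_le_of_lt h] using this
    · left
      have := hr (i - q.len) (by omega)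
      rw [show i - q.len + 1 = i + 1 - q.len by omega] at this
      rcases h.eq_or_lt with h | h
      · subst h
        simp only [Nat.sub_self, r.first] at this
        simpa [q.first] using this
      · simpa [h.not_ge, show ¬ i + 1 ≤ q.len by omega] using this
  · intro i hi j hj hij
    simp only [Set.mem_Iic] at hi hj
    dsimp only at hij
    split_ifs at hij with h1 h2 h2
    · have := q.inj (Nat.sub_le q.len i) (Nat.sub_le q.len j) hij
      omega
    · have := key _ (by omega) _ (by omega) hij
      omega
    · have := key _ (by omega) _ (by omega) hij.symm
      omega
    · have := r.inj (show i - q.len ≤ r.len by omega) (show j - q.len ≤ r.len by omega) hij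
      omega
  · refine ⟨Nat.le_add_right _ _, ?_, ?_⟩
    · intro i h
      have := hq (q.len - (i + 1)) (by omega)
      rw [show q.len - (i + 1) + 1 = q.len - i by omega] at this
      simpa [h.le, Nat.succ_le_of_lt h] using this
    · intro i h hi
      dsimp only at hi ⊢
      have := hr (i - q.len) (by omega)
      rw [show i - q.len + 1 = i + 1 - q.len by omega] at this
      rcases h.eq_or_lt with h | h
      · subst h
        simp only [Nat.sub_self, r.first] at this
        simpa [q.first] using this
      · simpa [h.not_ge, show ¬ i + 1 ≤ q.len by omega] using this

/-- The end of a path that is not blocked by `S` has a common ancestor with its start or with a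
member of `S`. -/
theorem Path.exists_common_ancestor {a b : V} {S : Set V} (p : G.Path a b) (hp : ¬ p.Blocked S) :
    ∃ s ∈ insert a S, ∃ c, Relation.ReflTransGen G.edge c s ∧
      Relation.ReflTransGen G.edge c b := by
  -- Invariant along the path: the current vertex is an ancestor of some `s`, or it was entered by a
  -- forward edge and shares an ancestor with `s`.
  suffices H : ∀ k ≤ p.len, ∃ s ∈ insert a S, Relation.ReflTransGen G.edge (p.node k) s ∨
      (0 < k ∧ G.edge (p.node (k - 1)) (p.node k) ∧ ∃ c, Relation.ReflTransGen G.edge c s ∧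
        Relation.ReflTransGen G.edge c (p.node k)) by
    obtain ⟨s, hs, h | ⟨-, -, h⟩⟩ := H p.len le_rfl
    · exact ⟨s, hs, b, p.last ▸ h, .refl⟩
    · exact ⟨s, hs, p.last ▸ h⟩
  intro k
  induction k with
  | zero => exact fun _ => ⟨a, Set.mem_insert _ _, Or.inl (by rw [p.first])⟩
  | succ k ih =>
    intro hk
    obtain ⟨s, hs, h⟩ := ih (by omega)
    rcases p.adj k (by omega) with hf | hb
    · refine ⟨s, hs, Or.inr ⟨Nat.succ_pos _, hf, ?_⟩⟩
      rcases h with h | ⟨-, -, c, h1, h2⟩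
      · exact ⟨_, h, .single hf⟩
      · exact ⟨c, h1, h2.tail hf⟩
    · rcases h with h | ⟨h0, h1, -⟩
      · exact ⟨s, hs, Or.inl (h.head hb)⟩
      -- Vertex `k` is a collider. Being open, it has a descendant `d` in `S`, which replaces `s`.
      · simp only [Path.Blocked, not_exists, not_and, not_or, not_forall, not_not] at hp
        obtain ⟨d, hd, hdS⟩ := (hp k h0 (by omega)).2 ⟨h0, by omega, h1, hb⟩
        exact ⟨d, Set.mem_insert_of_mem _ hdS, Or.inl (hd.head hb)⟩

theorem Path.blocked_empty_iff {a b : V} (p : G.Path a b) :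
    p.Blocked ∅ ↔ ∃ i, p.IsCollider i := by
  constructor
  · rintro ⟨i, -, -, h | h⟩
    · exact absurd h.2 (Set.notMem_empty _)
    · exact ⟨i, h.1⟩
  · rintro ⟨i, h⟩
    exact ⟨i, h.1, h.2.1, Or.inr ⟨h, fun _ _ => Set.notMem_empty _⟩⟩

/-- Marginal `d`-separation means that there is no common ancestor. -/
theorem not_dSep_empty_iff [Finite V] {a b : V} :
    ¬ G.DSep a b ∅ ↔ ∃ c, Relation.ReflTransGen G.edge c a ∧ Relation.ReflTransGen G.edge c b := by
  constructor
  · intro h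
    simp only [DSep, not_forall] at h
    obtain ⟨p, hp⟩ := h
    obtain ⟨s, hs, c, h⟩ := p.exists_common_ancestor hp
    obtain rfl : s = a := by simpa using hs
    exact ⟨c, h⟩
  · rintro ⟨c, ha, hb⟩ h
    obtain ⟨p, k, hp⟩ := exists_trek ha hb
    obtain ⟨i, hi⟩ := p.blocked_empty_iff.1 (h p)
    exact hp.not_isCollider i hi

/-- A path of length at least two that ends in `y` is blocked by any set of non-descendants
of `y` that contains all parents of `y` except possibly its start. -/
theorem Path.blocked_of_parents_subset {a y : V} {S : Set V} (p : G.Path a y) (hl : 2 ≤ p.len)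
    (hya : ¬ Relation.ReflTransGen G.edge y a) (hS : G.parents y \ {a} ⊆ S)
    (hd : ∀ d ∈ S, ¬ Relation.ReflTransGen G.edge y d) : p.Blocked S := by
  obtain ⟨n, hn⟩ : ∃ n, p.len = n + 1 := ⟨p.len - 1, by omega⟩
  have hlast : p.node (n + 1) = y := hn ▸ p.last
  rcases p.adj n (by omega) with h | h
  · refine ⟨n, by omega, by omega, Or.inl ⟨fun hc => not_edge_of_edge h hc.2.2.2, hS ⟨?_, ?_⟩⟩⟩
    · simpa only [parents, Set.mem_ofPred_eq, hlast] using h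
    · intro h0
      have := p.inj (show n ≤ p.len by omega) (Nat.zero_le p.len)
        ((Set.mem_singleton_iff.1 h0).trans p.first.symm)
      omega
  · classical
    -- The last edge leaves `y`. Walking back from `y` as long as the edges keep this direction
    -- stops before the start, which does not descend from `y`. The vertex where it stops is a
    -- collider descending from `y`, hence closed.
    have hex : ∃ j, j ≤ n ∧ ∀ i, j ≤ i → i < n + 1 → G.edge (p.node (i + 1)) (p.node i) :=
      ⟨n, le_rfl, fun i h1 h2 => by obtain rfl : i = n := by omega
                                    exact h⟩
    obtain ⟨hjn, hj⟩ := Nat.find_spec hex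
    set j := Nat.find hex with hjdef
    have hreach : Relation.ReflTransGen G.edge y (p.node j) := by
      simpa only [hlast] using p.backward_reach (k := j) (l := n + 1) (by omega) hj
    have hpos : 0 < j := by
      rcases Nat.eq_zero_or_pos j with h0 | h0
      · rw [h0, p.first] at hreach
        exact absurd hreach hya
      · exact h0
    have hfwd : G.edge (p.node (j - 1)) (p.node j) := by
      have h1 := p.adj (j - 1) (by omega)
      rw [Nat.sub_add_cancel hpos] at h1
      refine h1.resolve_right fun h2 => Nat.find_min hex (m := j - 1) (by omega)
        ⟨by omega, fun i hi hi' => ?_⟩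
      rcases hi.eq_or_lt with rfl | hlt
      · rwa [Nat.sub_add_cancel hpos]
      · exact hj i (by omega) hi'
    exact ⟨j, hpos, by omega, Or.inr ⟨⟨hpos, by omega, hfwd, hj j le_rfl (by omega)⟩,
      fun d hjd hdS => hd d hdS (hreach.trans hjd)⟩⟩

end

/-! ### Blocking properties of `pa(y) \ {x}` and the description of `ADE` -/

section

variable {V : Type*} {G : CausalDAG V} {x y : V}

theorem not_reflTransGen_of_edge {v : V} (h : G.edge v y) : ¬ Relation.ReflTransGen G.edge y v :=
  fun h' => G.acyclic v (Relation.TransGen.head' h h')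

theorem not_reflTransGen_of_not_isAncestor (hxy : x ≠ y) (hyx : ¬ G.IsAncestor y x) :
    ¬ Relation.ReflTransGen G.edge y x := fun h =>
  (Relation.reflTransGen_iff_eq_or_transGen.1 h).elim hxy hyx

/-- Each path concerned has length at least two, since a backdoor path of length one would make its
start a child of `y`; so `Path.blocked_of_parents_subset` applies. -/
theorem isGraphicalVAS_parents (hxy : x ≠ y) (hyx : ¬ G.IsAncestor y x) :
    G.IsGraphicalVAS x y (G.parents y \ {x}) := by
  have hyx' := not_reflTransGen_of_not_isAncestor hxy hyx
  have hlen : ∀ {v : V} (p : G.Path v y), ¬ Relation.ReflTransGen G.edge y v →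
      p.IsBackdoor → 2 ≤ p.len := by
    intro v p hv ⟨h0, h1⟩
    by_contra hl
    have h : p.len = 1 := by omega
    have h2 : p.node 1 = y := h ▸ p.last
    rw [p.first, h2] at h1
    exact hv (.single h1)
  have hlen' : ∀ {v : V} (p : G.Path v y), (∃ i, p.IsCollider i) → 2 ≤ p.len := by
    rintro v p ⟨i, h0, h1, -⟩
    omega
  have hx : ∀ p : G.Path x y, 2 ≤ p.len → p.Blocked (G.parents y \ {x}) := fun p hp =>
    p.blocked_of_parents_subset hp hyx' subset_rfl fun d hd => not_reflTransGen_of_edge hd.1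
  have hmed : ∀ v ∈ G.Z3 x y, ¬ Relation.ReflTransGen G.edge y v := fun v hv h =>
    G.acyclic v (hv.2.trans_left h)
  have hm : ∀ v ∈ G.Z3 x y, ∀ p : G.Path v y, 2 ≤ p.len →
      p.Blocked (insert x (G.parents y \ {x})) := fun v hv p hp =>
    p.blocked_of_parents_subset hp (hmed v hv)
      (fun d hd => by by_cases h : d = x <;> simp [h, hd.1])
      (by rintro d (rfl | hd)
          · exact hyx'
          · exact not_reflTransGen_of_edge hd.1)
  exact
    { backdoor_exposure := fun p hp => hx p (hlen p hyx' hp)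
      backdoor_mediators := fun v hv p hp => hm v hv p (hlen p (hmed v hv) hp)
      mediator_paths := fun p hp => hx p hp.1
      collider_paths_exposure := fun p hp => hx p (hlen' p hp)
      collider_paths_mediators := fun v hv p hp => hm v hv p (hlen' p hp) }

theorem ADE_subset (G : CausalDAG V) (x y : V) : G.ADE x y ⊆ G.parents y \ {x} := by
  rintro v ((⟨h, h'⟩ | ⟨h, h'⟩) | ⟨h, h'⟩)
  · exact ⟨h', h.1⟩
  · refine ⟨h', ?_⟩
    rintro rfl
    exact G.acyclic _ h.1
  · exact ⟨h', h.1⟩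

variable [Finite V]

theorem ADE_eq_parents (hxy : x ≠ y) (hyx : ¬ G.IsAncestor y x) (h : ¬ G.DSep x y ∅) :
    G.ADE x y = G.parents y \ {x} := by
  refine (ADE_subset G x y).antisymm ?_
  rintro v ⟨hvy, hvx⟩
  replace hvx : v ≠ x := hvx
  replace hvy : G.edge v y := hvy
  have hyx' := not_reflTransGen_of_not_isAncestor hxy hyx
  have hyv := not_reflTransGen_of_edge hvy
  have hvy' : v ≠ y := by
    rintro rfl
    exact hyv .refl
  by_cases hd : G.IsAncestor x v
  · exact Or.inl (Or.inr ⟨⟨hd, .single hvy⟩, hvy⟩)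
  by_cases hsep : G.DSep v x ∅
  · refine Or.inr ⟨⟨hvx, hvy', fun h => hyv h.to_reflTransGen, hsep, fun hs => ?_⟩, hvy⟩
    -- Prepend `v → y` to a trek from `y` to `x`. The trek starts with an edge into `y`, as `y` is
    -- no ancestor of `x`, so `y` becomes the only collider and conditioning on it opens the path.
    obtain ⟨c, hcx, hcy⟩ := not_dSep_empty_iff.1 h
    obtain ⟨p, k, hp⟩ := exists_trek hcy hcx
    have hk0 : 0 < k := by
      rcases Nat.eq_zero_or_pos k with rfl | hk
      · exact absurd (by simpa only [p.first, p.last] using hp.reach le_rfl) hyx'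
      · exact hk
    -- Every vertex of the trek shares its top with `x`, whereas `v` is separated from `x`.
    have hoff : ∀ i ≤ p.len, p.node i ≠ v := by
      rintro i hi rfl
      exact not_dSep_empty_iff.2 ⟨p.node k, hp.reach hi,
        by simpa only [p.last] using hp.reach le_rfl⟩
        hsep
    obtain ⟨i, hi0, hil, hb⟩ := hs (p.cons (Or.inl hvy) hoff)
    obtain ⟨i, rfl⟩ : ∃ j, i = j + 1 := ⟨i - 1, by omega⟩
    have hil' : i < p.len := by simpa [Path.cons] using hil
    rcases Nat.eq_zero_or_pos i with rfl | hi
    · have hcoll : (p.cons (Or.inl hvy) hoff).IsCollider 1 := by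
        refine ⟨by simp, hil, ?_, ?_⟩
        · simpa [Path.cons, p.first] using hvy
        · exact hp.2.1 0 hk0
      rcases hb with hb | hb
      · exact hb.1 hcoll
      · exact hb.2 _ .refl (by simp [Path.cons, p.first])
    · rcases hb with hb | hb
      · have h1 : p.node i = y := hb.2
        have := p.inj hil'.le (Nat.zero_le p.len) (h1.trans p.first.symm)
        omega
      · obtain ⟨⟨-, -, h2, h3⟩, -⟩ := hb
        refine hp.not_isCollider i ⟨hi, hil', ?_, h3⟩
        obtain ⟨j, rfl⟩ : ∃ j, i = j + 1 := ⟨i - 1, by omega⟩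
        exact h2
  -- A trek from `x` to `v` must begin with an edge into `x`, since `v` does not descend from `x`.
  -- Appending `v → y` keeps it a trek, hence an active backdoor path.
  · obtain ⟨c, hcv, hcx⟩ := not_dSep_empty_iff.1 hsep
    obtain ⟨p, k, hp⟩ := exists_trek hcx hcv
    have hk0 : 0 < k := by
      rcases Nat.eq_zero_or_pos k with rfl | hk
      · have : Relation.ReflTransGen G.edge x v := by
          simpa only [p.first, p.last] using hp.reach le_rfl
        exact ((Relation.reflTransGen_iff_eq_or_transGen.1 this).elim hvx hd).elim
      · exact hk
    have hoff : ∀ i ≤ p.len, p.node i ≠ y := by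
      rintro i hi h'
      have := hp.reach_ends hi
      rw [h'] at this
      exact this.elim hyx' hyv
    have hlen : 0 < p.len := hk0.trans_le hp.1
    refine Or.inl (Or.inl ⟨⟨hvx, hvy', hd, p.snoc (Or.inl hvy) hoff, ⟨by simp [Path.snoc], ?_⟩, ?_,
      p.len, hlen, by simp [Path.snoc], by simp [Path.snoc, p.last]⟩, hvy⟩)
    · simpa [Path.snoc, Nat.succ_le_of_lt hlen] using hp.2.1 0 hk0
    · rw [Path.blocked_empty_iff]
      refine fun ⟨i, hi⟩ => Path.IsTrek.not_isCollider (k := k) ⟨?_, ?_, ?_⟩ i hi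
      · exact hp.1.trans (Nat.le_succ _)
      · intro i hi
        have := hp.1
        simpa [Path.snoc, show i ≤ p.len by omega, show i + 1 ≤ p.len by omega] using hp.2.1 i hi
      · intro i hki hil
        rcases lt_or_ge i p.len with hi | hi
        · simpa [Path.snoc, hi.le, Nat.succ_le_of_lt hi] using hp.2.2 i hki hi
        · obtain rfl : i = p.len := by
            have : i < p.len + 1 := hil
            omega
          simpa [Path.snoc, p.last] using hvy

theorem Z3_eq_empty (h : G.DSep x y ∅) : G.Z3 x y = ∅ := by
  rw [Set.eq_empty_iff_forall_notMem]
  rintro v ⟨h1, h2⟩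
  exact not_dSep_empty_iff.2 ⟨x, .refl, (h1.trans h2).to_reflTransGen⟩ h

/-- A member of `Z1` or `Z3` would connect `x` and `y`. For `Z4`, a path open given `{y}` yields a
common ancestor of `x` with `v` or with `y`, and both are excluded. -/
theorem ADE_eq_empty (h : G.DSep x y ∅) : G.ADE x y = ∅ := by
  rw [Set.eq_empty_iff_forall_notMem]
  rintro v ((⟨⟨-, -, -, p, -, hp, -⟩, -⟩ | ⟨hv, -⟩) | ⟨⟨-, -, -, h1, h2⟩, -⟩)
  · exact hp (h p)
  · simp [Z3_eq_empty h] at hv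
  · simp only [DSep, not_forall] at h2
    obtain ⟨p, hp⟩ := h2
    obtain ⟨s, rfl | rfl, c, hcs, hcx⟩ := p.exists_common_ancestor hp
    · exact not_dSep_empty_iff.2 ⟨c, hcs, hcx⟩ h1
    · exact not_dSep_empty_iff.2 ⟨c, hcx, hcs⟩ h

theorem isGraphicalVAS_empty (h : G.DSep x y ∅) : G.IsGraphicalVAS x y ∅ where
  backdoor_exposure p _ := h p
  backdoor_mediators v hv := by simp [Z3_eq_empty h] at hv
  mediator_paths p _ := h p
  collider_paths_exposure p _ := h p
  collider_paths_mediators v hv := by simp [Z3_eq_empty h] at hv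

end

end CausalDAG

/-! ### Functions of independent noise -/

section

variable {Ω α β : Type*} {m' 𝓕 : MeasurableSpace Ω} [mΩ : MeasurableSpace Ω] [MeasurableSpace α]
  [MeasurableSpace β] {μ : Measure Ω} {S : Ω → α} {R : Ω → β}

/-- Disintegration of an event along an independent noise variable `R`. -/
theorem measureReal_inter_preimage_of_indep [IsProbabilityMeasure μ] (h𝓕 : 𝓕 ≤ mΩ)
    (hS : Measurable[𝓕] S) (hR : Measurable R)
    (h : Indep 𝓕 (MeasurableSpace.comap R inferInstance) μ)
    {B : Set (α × β)} (hB : MeasurableSet B) {F : Set Ω} (hF : MeasurableSet[𝓕] F) :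
    μ.real (F ∩ (fun ω => (S ω, R ω)) ⁻¹' B) =
      ∫ ω in F, (μ.map R).real (Prod.mk (S ω) ⁻¹' B) ∂μ := by
  have : IsProbabilityMeasure (μ.map R) := Measure.isProbabilityMeasure_map hR.aemeasurable
  -- Recording membership in `F` as a `Prop`-valued coordinate makes the event a preimage under `(K,
  -- R)`, whose law is a product, so Tonelli applies.
  let K : Ω → Prop × α := fun ω => (ω ∈ F, S ω)
  have hK : Measurable[𝓕] K := by
    refine Measurable.prodMk ?_ hS
    exact (@measurableSet_setOfPred _ 𝓕 _).1 hF
  have hK' : Measurable K := hK.mono h𝓕 le_rfl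
  have hind : IndepFun K R μ := indep_of_indep_of_le_left h hK.comap_le
  let D : Set ((Prop × α) × β) := {q | q.1.1 ∧ (q.1.2, q.2) ∈ B}
  have hD : MeasurableSet D := by
    refine MeasurableSet.inter (s₁ := {q : (Prop × α) × β | q.1.1})
      (s₂ := {q : (Prop × α) × β | (q.1.2, q.2) ∈ B}) ?_ ?_
    · exact measurableSet_setOfPred.2 measurable_fst.fst
    · exact hB.preimage (measurable_fst.snd.prodMk measurable_snd)
  have hmeas : Measurable fun ω => (μ.map R) (Prod.mk (S ω) ⁻¹' B) :=
    (measurable_measure_prodMk_left hB).comp (hS.mono h𝓕 le_rfl)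
  have key : μ (F ∩ (fun ω => (S ω, R ω)) ⁻¹' B) =
      ∫⁻ ω in F, (μ.map R) (Prod.mk (S ω) ⁻¹' B) ∂μ := by
    have h1 : F ∩ (fun ω => (S ω, R ω)) ⁻¹' B = (fun ω => (K ω, R ω)) ⁻¹' D := rfl
    rw [h1, ← Measure.map_apply (hK'.prodMk hR) hD,
      (indepFun_iff_map_prod_eq_prod_map_map hK'.aemeasurable hR.aemeasurable).1 hind,
      Measure.prod_apply hD, lintegral_map (measurable_measure_prodMk_left hD) hK',
      ← lintegral_indicator (h𝓕 _ hF)]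
    refine lintegral_congr fun ω => ?_
    by_cases hω : ω ∈ F
    · rw [Set.indicator_of_mem hω]
      congr 1
      ext r
      simp [K, D, hω]
    · rw [Set.indicator_of_notMem hω]
      have : Prod.mk (K ω) ⁻¹' D = ∅ := by
        ext r
        simp [K, D, hω]
      rw [this, measure_empty]
  rw [Measure.real, key]
  exact (integral_toReal hmeas.aemeasurable (ae_of_all _ fun _ => measure_lt_top _ _)).symm

/-- A function of `S` and of an independent noise variable `R` depends on the past `𝓕` only
through `S`. -/
theorem condIndepFun_of_indep_noise [StandardBorelSpace Ω] [IsProbabilityMeasure μ]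
    {γ δ : Type*} [MeasurableSpace γ] [MeasurableSpace δ] (h𝓕 : 𝓕 ≤ mΩ) (hm' : m' ≤ mΩ)
    (hm𝓕 : m' ≤ 𝓕)
    (hS : Measurable[m'] S) (hR : Measurable R)
    (h : Indep 𝓕 (MeasurableSpace.comap R inferInstance) μ)
    {g : α × β → γ} (hg : Measurable g) {T : Ω → δ} (hT : Measurable[𝓕] T) :
    CondIndepFun m' hm' (fun ω => g (S ω, R ω)) T μ := by
  have hS' : Measurable S := hS.mono hm' le_rfl
  have : IsProbabilityMeasure (μ.map R) := Measure.isProbabilityMeasure_map hR.aemeasurable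
  refine (condIndepFun_iff_condExp_inter_preimage_eq_mul (f := fun ω => g (S ω, R ω))
    (hg.comp (hS'.prodMk hR)) (hT.mono h𝓕 le_rfl)).2 ?_
  intro s t hs ht
  set φ : α → ℝ := fun c => (μ.map R).real (Prod.mk c ⁻¹' (g ⁻¹' s)) with hφ
  have hφm : Measurable φ := (measurable_measure_prodMk_left (hg hs)).ennreal_toReal
  have hφS : StronglyMeasurable[m'] (φ ∘ S) := (hφm.comp hS).stronglyMeasurable
  have hφb : ∀ c, ‖φ c‖ ≤ 1 := fun c => by
    rw [Real.norm_of_nonneg measureReal_nonneg]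
    exact measureReal_le_one
  have hA : MeasurableSet ((fun ω => g (S ω, R ω)) ⁻¹' s) := (hg.comp (hS'.prodMk hR)) hs
  -- Here `φ c` is the probability that `g (c, R)` lies in `s`. The choices `F = univ` and `F = T
  -- ⁻¹' t` together give the product formula.
  have key : ∀ F : Set Ω, MeasurableSet[𝓕] F →
      (μ⟦(fun ω => g (S ω, R ω)) ⁻¹' s ∩ F | m'⟧) =ᵐ[μ] (φ ∘ S) * (μ⟦F | m'⟧) := by
    intro F hF
    have hF' : MeasurableSet F := h𝓕 _ hF
    have hiF : Integrable (F.indicator fun _ => (1 : ℝ)) μ :=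
      (integrable_const 1).indicator hF'
    have hφi : Integrable ((φ ∘ S) * (F.indicator fun _ => (1 : ℝ))) μ :=
      hiF.bdd_mul (c := 1) (hφm.comp hS').aestronglyMeasurable (ae_of_all _ fun ω => hφb _)
    have hpull := condExp_mul_of_stronglyMeasurable_left hφS hφi hiF
    refine (Filter.EventuallyEq.symm ?_ : _ =ᵐ[μ] _)
    refine hpull.symm.trans ?_
    refine ae_eq_condExp_of_forall_setIntegral_eq hm' ?_ ?_ ?_ ?_
    · exact (integrable_const 1).indicator (hA.inter hF')
    · exact fun _ _ _ => integrable_condExp.integrableOn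
    · intro E hE _
      have hE' : MeasurableSet E := hm' _ hE
      rw [setIntegral_condExp hm' hφi hE]
      have h1 := measureReal_inter_preimage_of_indep h𝓕 (hS.mono hm𝓕 le_rfl) hR h (hg hs)
        (MeasurableSet.inter (hm𝓕 _ hE) hF)
      rw [setIntegral_indicator (hA.inter hF'), setIntegral_const, smul_eq_mul, mul_one]
      have h2 : E ∩ ((fun ω => g (S ω, R ω)) ⁻¹' s ∩ F) =
          E ∩ F ∩ (fun ω => (S ω, R ω)) ⁻¹' (g ⁻¹' s) := by
        ext ω
        simp only [Set.mem_inter_iff, Set.mem_preimage]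
        tauto
      rw [h2, h1, ← setIntegral_indicator hF']
      refine integral_congr_ae (ae_of_all _ fun ω => ?_)
      by_cases hω : ω ∈ F <;> simp [hω, hφ]
    · exact stronglyMeasurable_condExp.aestronglyMeasurable
  have h1 := key Set.univ MeasurableSet.univ
  have h2 := key (T ⁻¹' t) (hT ht)
  have h3 : (μ⟦Set.univ | m'⟧) = fun _ => (1 : ℝ) := by
    rw [Set.indicator_univ, condExp_const hm']
  rw [Set.inter_univ, h3] at h1
  filter_upwards [h1, h2] with ω h1 h2
  rw [h1, h2]
  simp

/-- On `E` the integrand equals `g (c, R)`, which is independent of the indicator of `E`. No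
integrability is needed. -/
theorem setIntegral_of_indep_noise (h𝓕 : 𝓕 ≤ mΩ) (hR : Measurable R)
    (h : Indep 𝓕 (MeasurableSpace.comap R inferInstance) μ) {g : α × β → ℝ} (hg : Measurable g)
    {E : Set Ω} (hE : MeasurableSet[𝓕] E) {c : α} (hEc : ∀ ω ∈ E, S ω = c) :
    ∫ ω in E, g (S ω, R ω) ∂μ = μ.real E * ∫ ω, g (c, R ω) ∂μ := by
  have hE' := h𝓕 _ hE
  have hgc : Measurable fun r => g (c, r) := hg.comp measurable_prodMk_left
  have hind : IndepFun (E.indicator fun _ => (1 : ℝ)) (fun ω => g (c, R ω)) μ := by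
    refine indep_of_indep_of_le_left (indep_of_indep_of_le_right h ?_) ?_
    · exact (hgc.comp (comap_measurable R)).comap_le
    · exact Measurable.comap_le (measurable_const.indicator hE)
  have h1 := hind.integral_fun_mul_eq_mul_integral
    (measurable_const.indicator hE').aestronglyMeasurable (hgc.comp hR).aestronglyMeasurable
  rw [integral_indicator_const _ hE', smul_eq_mul, mul_one] at h1
  rw [← h1, ← integral_indicator hE']
  refine integral_congr_ae (ae_of_all _ fun ω => ?_)
  by_cases hω : ω ∈ E
  · simp [hω, hEc ω hω]
  · simp [hω]

end

/-! ### Interventions, consistency and the adjustment formula -/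

namespace SCM

section

variable {V : Type*} {G : CausalDAG V} {𝓤 : V → Type*} [∀ i, MeasurableSpace (𝓤 i)]

/-- The σ-algebra generated by the exogenous variables with index in `N`. -/
@[reducible] def exogenous (𝓤 : V → Type*) [∀ i, MeasurableSpace (𝓤 i)] (N : Set V) :
    MeasurableSpace (∀ i, 𝓤 i) :=
  ⨆ i ∈ N, MeasurableSpace.comap (fun u : ∀ i, 𝓤 i => u i) inferInstance

theorem exogenous_le (N : Set V) : exogenous 𝓤 N ≤ MeasurableSpace.pi :=
  iSup₂_le fun i _ => (measurable_pi_apply i).comap_le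

theorem comap_le_exogenous {N : Set V} {i : V} (hi : i ∈ N) :
    MeasurableSpace.comap (fun u : ∀ i, 𝓤 i => u i) inferInstance ≤ exogenous 𝓤 N :=
  le_iSup₂_of_le i hi le_rfl

theorem Markovian.indep_exogenous {C : SCM G 𝓤} (hC : C.Markovian) {N N' : Set V}
    (h : Disjoint N N') : Indep (exogenous 𝓤 N) (exogenous 𝓤 N') C.law :=
  indep_iSup_of_disjoint (fun i => (measurable_pi_apply i).comap_le)
    ((iIndepFun_iff_iIndep _ _ _).1 hC) h

theorem doXM_eq_none {x : V} {M : Set V} {a : ℝ} {m : M → ℝ} {i : V} (hx : i ≠ x) (hM : i ∉ M) :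
    doXM x M a m i = none := by
  simp [doXM, hx, hM]

variable [Finite V]

/-- `N` is closed under parents, so solving the equations for a vertex of `N` uses only noise with
index in `N`. -/
theorem measurable_exogenous_value (C : SCM G 𝓤) {N : Set V}
    (hN : ∀ i j, G.edge i j → j ∈ N → i ∈ N) {i : V} (hi : i ∈ N) :
    Measurable[exogenous 𝓤 N] (fun u => C.value u i) := by
  induction i using G.wf.induction with
  | _ i ih =>
    have : (fun u => C.value u i) = fun u : (∀ i, 𝓤 i) =>
        Function.uncurry (C.f i) ((fun j : {j // G.edge j i} => C.value u j.1), u i) := by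
      funext u
      exact C.value_eq u i
    rw [this]
    refine (C.measurable_f i).comp (Measurable.prodMk ?_ ?_)
    · exact @measurable_pi_lambda _ _ _ (exogenous 𝓤 N) _ _ fun j : {j // G.edge j i} =>
        ih j.1 j.2 (hN _ _ j.2 hi)
    · exact Measurable.mono (comap_measurable _) (comap_le_exogenous hi) le_rfl

theorem measurable_exogenous_vec (C : SCM G 𝓤) {N : Set V}
    (hN : ∀ i j, G.edge i j → j ∈ N → i ∈ N) {S : Set V} (hS : S ⊆ N) :
    Measurable[exogenous 𝓤 N] (C.vec S) :=
  @measurable_pi_lambda _ _ _ (exogenous 𝓤 N) _ _ fun i =>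
    C.measurable_exogenous_value hN (hS i.2)

theorem measurable_potentialOutcome (C : SCM G 𝓤) (x y : V) (M : Set V) (a : ℝ) (m : M → ℝ) :
    Measurable (C.potentialOutcome x y M a m) :=
  (C.intervene (doXM x M a m)).measurable_value y

theorem intervene_value (C : SCM G 𝓤) (d : V → Option ℝ) (u : ∀ i, 𝓤 i) (i : V) :
    (C.intervene d).value u i =
      (d i).getD (C.f i (fun j => (C.intervene d).value u j.1) (u i)) := by
  rw [value_eq]
  simp only [intervene]
  cases d i <;> rfl

/-- Consistency: an intervention that sets variables to the values that they take anyway has no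
effect. -/
theorem intervene_value_eq_of_forall (C : SCM G 𝓤) (d : V → Option ℝ) (u : ∀ i, 𝓤 i)
    (h : ∀ i c, d i = some c → C.value u i = c) (i : V) :
    (C.intervene d).value u i = C.value u i := by
  induction i using G.wf.induction with
  | _ i ih =>
    rw [intervene_value]
    cases hd : d i with
    | some c => exact (h i c hd).symm
    | none =>
      rw [Option.getD_none, C.value_eq]
      congr 1
      funext j
      exact ih j.1 j.2

/-- An intervention affects only the descendants of its targets. -/
theorem intervene_value_eq_of_ancestral (C : SCM G 𝓤) (d : V → Option ℝ) (u : ∀ i, 𝓤 i)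
    {N : Set V} (hN : ∀ i j, G.edge i j → j ∈ N → i ∈ N) (hd : ∀ i ∈ N, d i = none)
    {i : V} (hi : i ∈ N) : (C.intervene d).value u i = C.value u i := by
  induction i using G.wf.induction with
  | _ i ih =>
    rw [intervene_value, hd i hi, Option.getD_none, C.value_eq]
    congr 1
    funext j
    exact ih j.1 j.2 (hN _ _ j.2 hi)

theorem potentialOutcome_eq_of_event (C : SCM G 𝓤) {x y : V} {S M : Set V} {a : ℝ} {s : S → ℝ}
    {m : M → ℝ} {u : ∀ i, 𝓤 i} (hu : u ∈ C.event x S M a s m) :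
    C.potentialOutcome x y M a m u = C.value u y := by
  refine C.intervene_value_eq_of_forall _ u (fun i c hic => ?_) y
  obtain ⟨hx, -, hm⟩ := hu
  unfold doXM at hic
  split_ifs at hic with h1 h2
  · rw [h1, hx]
    exact Option.some_injective _ hic
  · rw [← Option.some_injective _ hic, ← hm]
    rfl

/-- All potential outcomes are measurable functions of the variables in `S` and of an exogenous
variable, with values in `β`, that is independent of the exogenous variables of `N`. -/
def FactorsThrough (C : SCM G 𝓤) (x y : V) (M S : Set V) (N : Set V)
    (β : Type*) [MeasurableSpace β] : Prop :=
  ∀ (a : ℝ) (m : M → ℝ), ∃ (R : (∀ i, 𝓤 i) → β) (g : (S → ℝ) × β → ℝ), Measurable R ∧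
    Measurable g ∧ Indep (exogenous 𝓤 N) (MeasurableSpace.comap R inferInstance) C.law ∧
    C.potentialOutcome x y M a m = fun u => g (C.vec S u, R u)

variable {C : SCM G 𝓤} {x y : V} {M S N : Set V}
  {β : Type*} [MeasurableSpace β]

/-- Enlarging `S` to `A` inside the past does no harm, so one factorization through `A \ M` serves
both conditioning sets. -/
theorem FactorsThrough.noLatentConfounding [∀ i, StandardBorelSpace (𝓤 i)]
    (h : C.FactorsThrough x y M S N β) {A : Set V} (hSA : S ⊆ A)
    (hx : Measurable[exogenous 𝓤 N] fun u => C.value u x) (hM : Measurable[exogenous 𝓤 N] (C.vec M))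
    (hA : Measurable[exogenous 𝓤 N] (C.vec A)) : C.NoLatentConfounding x y M A := by
  have hvec : ∀ {B : Set V}, S ⊆ B →
      Measurable[MeasurableSpace.comap (C.vec B) inferInstance] (C.vec S) := fun {B} hB =>
    Measurable.comp (g := fun (b : B → ℝ) (i : S) => b ⟨i.1, hB i.2⟩)
      (measurable_pi_lambda _ fun i => measurable_pi_apply _) (comap_measurable _)
  intro a m
  obtain ⟨R, g, hR, hg, hind, heq⟩ := h a m
  rw [heq]
  refine ⟨condIndepFun_of_indep_noise (exogenous_le N) _ hA.comap_le (hvec hSA) hR hind hg hx,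
    condIndepFun_of_indep_noise (exogenous_le N) _ (Measurable.comap_le ?_)
      (hvec (hSA.trans (Set.subset_insert x A))) hR hind hg hM⟩
  refine @measurable_pi_lambda _ _ _ (exogenous 𝓤 N) _ _ fun i => ?_
  by_cases hi : i.1 = x
  · simpa only [vec, hi] using hx
  · exact (measurable_pi_apply (⟨i.1, i.2.resolve_left hi⟩ : A)).comp hA

theorem measurableSet_event (C : SCM G 𝓤) {ℱ : MeasurableSpace (∀ i, 𝓤 i)}
    (hx : Measurable[ℱ] fun u => C.value u x)
    (hM : Measurable[ℱ] (C.vec M)) (hS : Measurable[ℱ] (C.vec S)) (a : ℝ) (s : S → ℝ)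
    (m : M → ℝ) : MeasurableSet[ℱ] (C.event x S M a s m) :=
  MeasurableSet.inter (hx (measurableSet_singleton a))
    (MeasurableSet.inter (hS (measurableSet_singleton s)) (hM (measurableSet_singleton m)))

theorem integrable_cond_event (C : SCM G 𝓤) (a : ℝ) (s : S → ℝ) (m : M → ℝ)
    (hi : Integrable (C.potentialOutcome x y M a m) C.law) :
    Integrable (fun u => C.value u y) (C.law[|C.event x S M a s m]) := by
  have hE : MeasurableSet (C.event x S M a s m) :=
    C.measurableSet_event (C.measurable_value x) (C.measurable_vec M) (C.measurable_vec S) a s m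
  have h1 : Integrable (C.potentialOutcome x y M a m) (C.law[|C.event x S M a s m]) := by
    by_cases h0 : C.law (C.event x S M a s m) = 0
    · rw [cond_eq_zero_of_meas_eq_zero h0]
      exact integrable_zero_measure
    · exact hi.restrict.smul_measure (ENNReal.inv_ne_top.2 h0)
  refine h1.congr ?_
  filter_upwards [ae_cond_mem hE] with u hu
  exact C.potentialOutcome_eq_of_event hu

/-- By consistency and independence, `E[Y | a, s, m]` is the mean of `g (s, R)`, and so is the mean
of the potential outcome given `S = s` alone. Summing over `s` is countable additivity. -/
theorem FactorsThrough.hasSum (h : C.FactorsThrough x y M S N β)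
    (hx : Measurable[exogenous 𝓤 N] fun u => C.value u x) (hM : Measurable[exogenous 𝓤 N] (C.vec M))
    (hS : Measurable[exogenous 𝓤 N] (C.vec S)) (hD : C.DiscreteOn S) {a : ℝ} {m : M → ℝ}
    (hpos : ∀ s, 0 < C.prob S s → 0 < C.law.real (C.event x S M a s m))
    (hi : Integrable (C.potentialOutcome x y M a m) C.law) :
    HasSum (fun s => C.condMean x y S M a s m * C.prob S s)
      (∫ u, C.potentialOutcome x y M a m u ∂C.law) := by
  obtain ⟨R, g, hR, hg, hind, heq⟩ := h a m
  have hterm : ∀ s, C.condMean x y S M a s m * C.prob S s =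
      ∫ u in {u | C.vec S u = s}, C.potentialOutcome x y M a m u ∂C.law := by
    intro s
    have hsm : MeasurableSet[exogenous 𝓤 N] {u | C.vec S u = s} := hS (measurableSet_singleton s)
    have hE := C.measurableSet_event hx hM hS a s m
    rcases (show 0 ≤ C.prob S s from measureReal_nonneg).eq_or_lt with h0 | h0
    · rw [← h0, mul_zero, setIntegral_measure_zero]
      exact (measureReal_eq_zero_iff).1 h0.symm
    · have hp := hpos s h0
      have h1 : ∫ u in C.event x S M a s m, C.value u y ∂C.law =
          C.law.real (C.event x S M a s m) * ∫ u, g (s, R u) ∂C.law := by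
        rw [← setIntegral_of_indep_noise (exogenous_le N) hR hind hg hE (fun u hu => hu.2.1)]
        refine setIntegral_congr_fun (exogenous_le N _ hE) fun u hu => ?_
        rw [← C.potentialOutcome_eq_of_event hu, heq]
      have h2 : C.condMean x y S M a s m = ∫ u, g (s, R u) ∂C.law := by
        rw [condMean, ProbabilityTheory.cond, integral_smul_measure, h1, ENNReal.toReal_inv,
          smul_eq_mul]
        exact inv_mul_cancel_left₀ hp.ne' _
      rw [h2, heq, setIntegral_of_indep_noise (exogenous_le N) hR hind hg hsm (fun u hu => hu),
        mul_comm]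
      rfl
  simp_rw [hterm]
  choose! D hDc hDae using hD
  -- Countable because `S` is finite; values outside `Q` have probability zero and contribute
  -- nothing.
  let Q : Set (S → ℝ) := Set.univ.pi fun i => D i.1
  have hQ : Q.Countable := Set.countable_univ_pi fun i => hDc i.1 i.2
  have hQae : ∀ᵐ u ∂C.law, C.vec S u ∈ Q := by
    have : ∀ᵐ u ∂C.law, ∀ i : S, C.value u i.1 ∈ D i.1 := ae_all_iff.2 fun i => hDae i.1 i.2
    filter_upwards [this] with u hu i _
    exact hu i
  have : Countable Q := hQ
  have hsum := hasSum_integral_iUnion (μ := C.law) (f := C.potentialOutcome x y M a m)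
    (s := fun s : Q => {u | C.vec S u = s})
    (fun s => C.measurable_vec S (measurableSet_singleton s.1))
    (fun s t hst => Set.disjoint_left.2 fun u hu hu' => hst (Subtype.ext (hu.symm.trans hu')))
    hi.integrableOn
  have hU : (⋃ s : Q, {u | C.vec S u = s}) =ᵐ[C.law] (Set.univ : Set (∀ i, 𝓤 i)) := by
    rw [Filter.eventuallyEq_univ]
    filter_upwards [hQae] with u hu
    exact Set.mem_iUnion.2 ⟨⟨_, hu⟩, rfl⟩
  rw [setIntegral_congr_set hU, setIntegral_univ] at hsum
  refine (hasSum_subtype_iff_of_support_subset ?_).1 hsum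
  intro s hs
  by_contra hsQ
  refine hs (setIntegral_measure_zero _ ?_)
  refine measure_mono_null (fun u hu => ?_) (ae_iff.1 hQae)
  rw [← show C.vec S u = s from hu] at hsQ
  exact hsQ

theorem FactorsThrough.identifies {A : Set V} (h : C.FactorsThrough x y M (A \ M) N β)
    (hx : Measurable[exogenous 𝓤 N] fun u => C.value u x)
    (hM : Measurable[exogenous 𝓤 N] (C.vec M)) (hS : Measurable[exogenous 𝓤 N] (C.vec (A \ M))) :
    C.Identifies x y M A := by
  intro a a' hD hp hp' hi hi'
  have hD' : C.DiscreteOn (A \ M) := fun i hiA => hD i (Or.inl hiA.1)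
  have key : ∀ m : M → ℝ, 0 < C.prob M m →
      HasSum (fun s : ↥(A \ M) → ℝ =>
        (C.condMean x y (A \ M) M a s m - C.condMean x y (A \ M) M a' s m) *
          C.prob (A \ M) s) (C.CDE x y M a a' m) := by
    intro m hm
    have h1 := h.hasSum hx hM hS hD' (fun s hs => hp s m hs hm) (hi m hm)
    have h2 := h.hasSum hx hM hS hD' (fun s hs => hp' s m hs hm) (hi' m hm)
    simp only [sub_mul]
    exact h1.sub h2
  refine ⟨fun m hm => ⟨fun s _ => ⟨C.integrable_cond_event a s m (hi m hm),
    C.integrable_cond_event a' s m (hi' m hm)⟩, key m hm⟩, fun _ => ?_⟩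
  refine tsum_congr fun m => ?_
  rcases (show 0 ≤ C.prob M m from measureReal_nonneg).eq_or_lt with h0 | h0
  · simp only [← h0, mul_zero, tsum_zero]
  · exact ((key m h0).mul_right _).tsum_eq.symm

/-- A graphically valid set is a valid adjustment set if, whatever mediators are held fixed, the
potential outcomes depend on the past only through the remaining members of the set. -/
theorem isVAS_of_factorsThrough [∀ i, StandardBorelSpace (𝓤 i)] {A : Set V}
    (hG : G.IsGraphicalVAS x y A) {N : Set V} (hN : ∀ i j, G.edge i j → j ∈ N → i ∈ N)
    (hx : x ∈ N) (hA : A ⊆ N) (hZ : G.Z3 x y ⊆ N)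
    (h : ∀ M, G.IsMediatorSet x y M → C.FactorsThrough x y M (A \ M) N β) :
    C.IsVAS x y A where
  graphical := hG
  no_latent_confounding M hM :=
    have hx' := C.measurable_exogenous_value hN hx
    have hM' := C.measurable_exogenous_vec hN (hM.2.trans hZ)
    ⟨(h M hM).noLatentConfounding Set.sdiff_subset hx' hM'
      (C.measurable_exogenous_vec hN hA),
    (h M hM).noLatentConfounding subset_rfl hx' hM'
      (C.measurable_exogenous_vec hN (Set.sdiff_subset.trans hA))⟩
  identifies M hM := (h M hM).identifies (C.measurable_exogenous_value hN hx)
    (C.measurable_exogenous_vec hN (hM.2.trans hZ))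
    (C.measurable_exogenous_vec hN (Set.sdiff_subset.trans hA))

/-- Take `N` to be the non-descendants of `y`: the noise of `y` is independent of theirs, and the
parents of `y` outside `M` and other than `x` keep their natural values under the intervention. -/
theorem isVAS_parents [∀ i, StandardBorelSpace (𝓤 i)] (hC : C.Markovian) (hxy : x ≠ y)
    (hyx : ¬ G.IsAncestor y x) : C.IsVAS x y (G.parents y \ {x}) := by
  classical
  refine isVAS_of_factorsThrough (β := 𝓤 y) (CausalDAG.isGraphicalVAS_parents hxy hyx)
    (N := {i | ¬ Relation.ReflTransGen G.edge y i}) (fun i j hij hj hi => hj (hi.tail hij))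
    (CausalDAG.not_reflTransGen_of_not_isAncestor hxy hyx)
    (fun i hi => CausalDAG.not_reflTransGen_of_edge hi.1)
    (fun i hi hyi => G.acyclic i (hi.2.trans_left hyi)) ?_
  intro M hM a m
  -- A parent of `y` that descends from `x` is a mediator, and `M` contains all mediators in
  -- `pa(y)`.
  have hnd : ∀ j : {j // G.edge j y}, j.1 ≠ x → j.1 ∉ M →
      ¬ Relation.ReflTransGen G.edge x j.1 := fun j hjx hjM hxj =>
    hjM (hM.1 ⟨⟨(Relation.reflTransGen_iff_eq_or_transGen.1 hxj).resolve_left hjx,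
      .single j.2⟩, j.2⟩)
  let w : (↥((G.parents y \ {x}) \ M) → ℝ) → {j // G.edge j y} → ℝ := fun s j =>
    if hx : j.1 = x then a else if hM : j.1 ∈ M then m ⟨j.1, hM⟩ else s ⟨j.1, ⟨j.2, hx⟩, hM⟩
  have hw : Measurable w := by
    refine measurable_pi_lambda _ fun j => ?_
    by_cases h1 : j.1 = x
    · simp only [w, dif_pos h1]
      exact measurable_const
    by_cases h2 : j.1 ∈ M
    · simp only [w, dif_neg h1, dif_pos h2]
      exact measurable_const
    · simp only [w, dif_neg h1, dif_neg h2]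
      exact measurable_pi_apply _
  refine ⟨fun u => u y, fun q => C.f y (w q.1) q.2, measurable_pi_apply y,
    (C.measurable_f y).comp ((hw.comp measurable_fst).prodMk measurable_snd), ?_, ?_⟩
  · refine indep_of_indep_of_le_right (hC.indep_exogenous (N' := {y}) ?_)
      (comap_le_exogenous (Set.mem_singleton y))
    exact Set.disjoint_singleton_right.2 fun h => h .refl
  · funext u
    rw [potentialOutcome, intervene_value,
      doXM_eq_none hxy.symm fun hy => G.acyclic y (hM.2 hy).2, Option.getD_none]
    congr 1
    funext j
    simp only [w]
    split_ifs with h1 h2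
    · rw [intervene_value]
      simp [doXM, h1]
    · rw [intervene_value]
      simp [doXM, h1, h2]
    · refine C.intervene_value_eq_of_ancestral _ u
        (N := {i | ¬ Relation.ReflTransGen G.edge x i}) (fun i k hik hk hi => hk (hi.tail hik))
        (fun i hi => doXM_eq_none ?_ ?_) (hnd j h1 h2)
      · rintro rfl
        exact hi .refl
      · exact fun hiM => hi (hM.2 hiM).1.to_reflTransGen

/-- There are no mediators and `x` is no ancestor of `y`, so the intervention leaves `Y` unchanged.
`Y` and `X` are functions of the noise of disjoint ancestral sets. -/
theorem isVAS_empty [∀ i, StandardBorelSpace (𝓤 i)] (hC : C.Markovian) (h : G.DSep x y ∅) :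
    C.IsVAS x y ∅ := by
  refine isVAS_of_factorsThrough (β := ℝ) (CausalDAG.isGraphicalVAS_empty h)
    (N := {i | Relation.ReflTransGen G.edge i x}) (fun i j hij hj => hj.head hij) .refl
    (Set.empty_subset _) (by simp [CausalDAG.Z3_eq_empty h]) ?_
  intro M hM a m
  have hsep : ∀ i, Relation.ReflTransGen G.edge i x → ¬ Relation.ReflTransGen G.edge i y :=
    fun i hix hiy => CausalDAG.not_dSep_empty_iff.2 ⟨i, hix, hiy⟩ h
  have hanc : ∀ i j, G.edge i j → j ∈ {i | Relation.ReflTransGen G.edge i y} →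
      i ∈ {i | Relation.ReflTransGen G.edge i y} := fun i j hij hj => hj.head hij
  refine ⟨C.potentialOutcome x y M a m, Prod.snd, C.measurable_potentialOutcome x y M a m,
    measurable_snd, ?_, rfl⟩
  have heq : C.potentialOutcome x y M a m = fun u => C.value u y := by
    funext u
    refine C.intervene_value_eq_of_ancestral _ u hanc (fun i hi => doXM_eq_none ?_ ?_) .refl
    · rintro rfl
      exact hsep i .refl hi
    · exact fun hiM => by simpa [CausalDAG.Z3_eq_empty h] using hM.2 hiM
  rw [heq]
  refine indep_of_indep_of_le_right (hC.indep_exogenous ?_)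
    (C.measurable_exogenous_value hanc .refl).comap_le
  exact Set.disjoint_left.2 hsep

end

end SCM

theorem theorem3 {V : Type*} [Finite V] (G : CausalDAG V) (𝓤 : V → Type*)
    [∀ i, MeasurableSpace (𝓤 i)] [∀ i, StandardBorelSpace (𝓤 i)]
    (C : SCM G 𝓤) (hC : C.Markovian) (x y : V) (hxy : x ≠ y) (hyx : ¬ G.IsAncestor y x) :
    C.IsVAS x y (G.ADE x y) ∧
      C.IsVAS x y (G.parents y \ {x}) ∧
      (¬ G.DSep x y ∅ → G.ADE x y = G.parents y \ {x}) := by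
  have hpa := SCM.isVAS_parents hC hxy hyx
  refine ⟨?_, hpa, CausalDAG.ADE_eq_parents hxy hyx⟩
  by_cases h : G.DSep x y ∅
  · rw [CausalDAG.ADE_eq_empty h]
    exact SCM.isVAS_empty hC h
  · rwa [CausalDAG.ADE_eq_parents hxy hyx h]
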